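/- All graphs are finite and simple, $K_s$ is the complete graph on $s$ vertices, $\alpha(G)$ is the independence number of $G$, and logarithms are to base $2$. For positive integers $t,m$ let $R(t,m)$ be the least $n$ such that every graph on $n$ vertices contains a $K_t$ or an independent set of size $m$. For $t\ge 2$ and real $x\ge 0$ let $Q(t,x)$ be the minimum of $\alpha(G)$ over all $K_t$-free graphs $G$ on $\lceil x\rceil$ vertices. For a graph $H$ and a function $g$ let $\mathrm{RT}(n,H,g(n))$ be the maximum number of edges of an $H$-free graph $G$ on $n$ vertices with $\alpha(G)<g(n)$ (and $0$ if there is no such graph). Let $\overline{\varrho}(H,g)$ and $\underline{\varrho}(H,g)$ be the $\limsup$ and the $\liminf$ of $\mathrm{RT}(n,H,g(n))/n^2$ as $n\to\infty$; if they are equal, their common value is denoted $\varrho(H,g)$. Let $p\ge 3$ and $q\ge 2$ be integers, let $\omega(n)\to\infty$, and let $$f(n)=n\,2^{-\omega(n)(\log n)^{(q-2)/(q-1)}} .$$ Consider the condition $$(\ast)\qquad\text{there is a constant }\vartheta>0\text{ such that } R\bigl(p-1,Q(p,f(n))\bigr)<n^{1-\vartheta}\text{ for all sufficiently large } n.$$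 (a) If $(\ast)$ holds, then $$\overline{\varrho}\bigl(K_{pq-1},Q(p,f)\bigr)\le\frac12\left(1-\frac1{q-1}\right).$$ (b) Let $1\le i\le p-1$ and $t=\left\lfloor\frac{pq-i-1}{q-1}\right\rfloor$; then $t\ge p$. Let $g$ be a function with $$Q\left(t+1,\frac n{q-1}\right)<g(n)\le Q\bigl(p,f(n)\bigr)$$ for all sufficiently large $n$. Then $\underline{\varrho}(K_{pq-i},g)\ge\frac12\left(1-\frac1{q-1}\right)$, and if $(\ast)$ holds, then $\varrho(K_{pq-i},g)$ exists and $$\varrho(K_{pq-i},g)=\frac12\left(1-\frac1{q-1}\right).$$ -/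

import Mathlib

open Filter

noncomputable section

namespace RamseyTuran

/-- The Ramsey number `R(t, m)`: the least `n` such that every graph on `n` vertices contains
a clique of size `t` or an independent set of size `m`. -/
def ramseyNum (t m : ℕ) : ℕ :=
  sInf {n : ℕ | ∀ G : SimpleGraph (Fin n),
    (∃ S : Finset (Fin n), G.IsNClique t S) ∨ (∃ S : Finset (Fin n), G.IsNIndepSet m S)}

/-- The inverse Ramsey function `Q(t, x)`: the minimum independence number of a `K_t`-free graph
on `x` vertices. A real argument is rounded up to an integer. -/
def invRamsey (t : ℕ) (x : ℝ) : ℕ :=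
  sInf {a : ℕ | ∃ G : SimpleGraph (Fin ⌈x⌉₊), G.CliqueFree t ∧ G.indepNum = a}

/-- The Ramsey–Turán number `RT(n, H, m)`: the maximum number of edges of an `H`-free graph on
`n` vertices whose independence number is less than `m` (and `0` if there is no such graph). -/
def rtNum {W : Type*} (n : ℕ) (H : SimpleGraph W) (m : ℝ) : ℕ :=
  sSup {e : ℕ | ∃ G : SimpleGraph (Fin n),
    H.Free G ∧ (G.indepNum : ℝ) < m ∧ G.edgeSet.ncard = e}

/-- The upper Ramsey–Turán density of `H` with respect to `f`. The sequence takes its values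
in `[0, 1/2]`, so that the real `limsup` is the usual one. -/
def upperDensity {W : Type*} (H : SimpleGraph W) (f : ℕ → ℝ) : ℝ :=
  limsup (fun n : ℕ => (rtNum n H (f n) : ℝ) / (n : ℝ) ^ 2) atTop

/-- The lower Ramsey–Turán density of `H` with respect to `f`. -/
def lowerDensity {W : Type*} (H : SimpleGraph W) (f : ℕ → ℝ) : ℝ :=
  liminf (fun n : ℕ => (rtNum n H (f n) : ℝ) / (n : ℝ) ^ 2) atTop

/-- The Ramsey–Turán density of `H` with respect to `f` exists and equals `c`. -/
def HasDensity {W : Type*} (H : SimpleGraph W) (f : ℕ → ℝ) (c : ℝ) : Prop :=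
  upperDensity H f = c ∧ lowerDensity H f = c

/-- The function `f(n) = n * 2 ^ (-ω(n) * (log n) ^ ((q - 2) / (q - 1)))`, logarithm to base 2. -/
def fFun (q : ℕ) (ω : ℕ → ℝ) (n : ℕ) : ℝ :=
  (n : ℝ) * (2 : ℝ) ^ (-(ω n * (Real.logb 2 (n : ℝ)) ^ (((q : ℝ) - 2) / ((q : ℝ) - 1))))

/-- There is a constant `ϑ > 0` such that `R(p - 1, Q(p, f(n))) < n ^ (1 - ϑ)` for all
sufficiently large `n`. -/
def RamseyGap (p : ℕ) (f : ℕ → ℝ) : Prop :=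
  ∃ ϑ : ℝ, 0 < ϑ ∧ ∀ᶠ n : ℕ in atTop,
    (ramseyNum (p - 1) (invRamsey p (f n)) : ℝ) < (n : ℝ) ^ (1 - ϑ)

end RamseyTuran

end

namespace RamseyTuran

open Finset

/-! Put `r = q - 1`. Upper bound: suppose the edge density exceeds the bound by a fixed amount.
Supersaturation gives a positive proportion of ordered copies of `K_{r+1}`, a dense set of
`(r+1)`-tuples. Read it as a relation between first coordinates and `r`-tuples. Dependent random
choice finds at least `f(n)` first coordinates, any `p` of which have many common `r`-tuples. Since
`α(G) < Q(p, f(n))`, these coordinates contain a `K_p`, and its common `r`-tuples form the next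
dense set. After `r` rounds at least `n^(1-ϑ)` vertices remain, which contain a `K_{p-1}` by the
Ramsey condition. Everything found is completely joined, so there is a clique on `pr + (p - 1) = pq
- 1` vertices (`exists_isNClique_of_dense_tuples`, `eventually_not_cliqueFree`).

The exponent `(q-2)/(q-1) = 1 - 1/r` comes from the densities `2^(-a j)`: in `r` rounds `a j` grows
geometrically from a constant to `ϑ log n`, so its ratio is of order `(log n)^(1/r)`. A round
shrinks the candidate set by about `2^(-log n / ratio)`, which the factor `ω → ∞` absorbs
(`exists_parameters`).

Lower bound: join `r` extremal graphs for `Q(t+1, n/r)`. Cliques have at most `rt` vertices, and an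
independent set lies in a single part (`le_rtNum`). -/

/-! ### Cliques forced by a small independence number; Ramsey's theorem. -/

/-- A set with at least `k` elements contains the image of an embedding of `Fin k`. -/
lemma exists_embedding_mem {V : Type*} {U : Finset V} {k : ℕ} (h : k ≤ #U) :
    ∃ e : Fin k ↪ V, ∀ i, e i ∈ U := by
  obtain ⟨W, hWU, hW⟩ := Finset.exists_subset_card_eq h
  refine ⟨(W.equivFinOfCardEq hW).symm.toEmbedding.trans (Function.Embedding.subtype _), ?_⟩
  intro i
  exact hWU ((W.equivFinOfCardEq hW).symm i).2

/-- An independent set of a pulled back graph is independent in the original graph. -/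
lemma isNIndepSet_map_of_comap {V W : Type*} {G : SimpleGraph V} (e : W ↪ V) {k : ℕ}
    {S : Finset W} (hS : (G.comap e).IsNIndepSet k S) : G.IsNIndepSet k (S.map e) := by
  refine ⟨?_, by rw [card_map]; exact hS.2⟩
  intro a ha b hb hab
  simp only [coe_map, Set.mem_image, mem_coe] at ha hb
  obtain ⟨a, ha, rfl⟩ := ha
  obtain ⟨b, hb, rfl⟩ := hb
  exact hS.1 ha hb (fun h => hab (by rw [h]))

/-- A clique of a pulled back graph is a clique of the original graph. -/
lemma isNClique_map_of_comap {V W : Type*} {G : SimpleGraph V} (e : W ↪ V) {k : ℕ}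
    {S : Finset W} (hS : (G.comap e).IsNClique k S) : G.IsNClique k (S.map e) := by
  refine ⟨?_, by rw [card_map]; exact hS.2⟩
  intro a ha b hb hab
  simp only [coe_map, Set.mem_image, mem_coe] at ha hb
  obtain ⟨a, ha, rfl⟩ := ha
  obtain ⟨b, hb, rfl⟩ := hb
  exact hS.1 ha hb (fun h => hab (by rw [h]))

lemma le_indepNum_of_isNIndepSet {V : Type*} [Finite V] {G : SimpleGraph V} {k : ℕ}
    {S : Finset V} (hS : G.IsNIndepSet k S) : k ≤ G.indepNum := by
  have := SimpleGraph.IsIndepSet.card_le_indepNum hS.1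
  rwa [hS.2] at this

/-- If the independence number is below `Q(p, x)`, every set of `x` vertices contains `K_p`. -/
lemma exists_isNClique_of_indepNum_lt_invRamsey {V : Type*} [Finite V] {G : SimpleGraph V}
    {p : ℕ} {x : ℝ} (hG : G.indepNum < invRamsey p x) {U : Finset V} (hU : x ≤ #U) :
    ∃ S ⊆ U, G.IsNClique p S := by
  obtain ⟨e, he⟩ := exists_embedding_mem (U := U) (Nat.ceil_le.2 hU)
  have hnot : ¬ (G.comap e).CliqueFree p := by
    intro hfree
    have h1 : invRamsey p x ≤ (G.comap e).indepNum := Nat.sInf_le ⟨_, hfree, rfl⟩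
    obtain ⟨S, hS⟩ := (G.comap e).exists_isNIndepSet_indepNum
    have h2 := le_indepNum_of_isNIndepSet (isNIndepSet_map_of_comap e hS)
    omega
  simp only [SimpleGraph.CliqueFree, not_forall, not_not] at hnot
  obtain ⟨S, hS⟩ := hnot
  refine ⟨S.map e, ?_, isNClique_map_of_comap e hS⟩
  intro v hv
  obtain ⟨i, -, rfl⟩ := mem_map.1 hv
  exact he i

/-- **Ramsey's theorem** for two colours. -/
theorem exists_ramsey_bound (t m : ℕ) : ∃ N : ℕ, ∀ (V : Type) (G : SimpleGraph V) (U : Finset V),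
    N ≤ #U → (∃ S ⊆ U, G.IsNClique t S) ∨ (∃ S ⊆ U, G.IsNIndepSet m S) := by
  classical
  induction t generalizing m with
  | zero => exact ⟨0, fun V G U _ => Or.inl ⟨∅, by simp, by simp⟩⟩
  | succ t iht =>
    induction m with
    | zero => exact ⟨0, fun V G U _ => Or.inr ⟨∅, by simp, by simp [SimpleGraph.isNIndepSet_iff]⟩⟩
    | succ m ihm =>
      obtain ⟨N₁, h₁⟩ := iht (m + 1)
      obtain ⟨N₂, h₂⟩ := ihm
      refine ⟨N₁ + N₂ + 1, fun V G U hU => ?_⟩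
      obtain ⟨v, hv⟩ : U.Nonempty := card_pos.1 (by omega)
      have hcard : #((U.erase v).filter (G.Adj v)) + #((U.erase v).filter (fun w => ¬ G.Adj v w))
          = #U - 1 := by
        rw [card_filter_add_card_filter_not, card_erase_of_mem hv]
      rcases Nat.lt_or_ge (#((U.erase v).filter (G.Adj v))) N₁ with hlt | hge
      · rcases h₂ V G ((U.erase v).filter (fun w => ¬ G.Adj v w)) (by omega) with
          ⟨S, hSU, hS⟩ | ⟨S, hSU, hS⟩
        · exact Or.inl ⟨S, hSU.trans ((filter_subset _ _).trans (erase_subset _ _)), hS⟩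
        · refine Or.inr ⟨insert v S, insert_subset hv
            (hSU.trans ((filter_subset _ _).trans (erase_subset _ _))), ?_⟩
          rw [← SimpleGraph.isNClique_compl] at hS ⊢
          refine hS.insert fun b hb => ?_
          have := hSU hb
          simp only [mem_filter, mem_erase] at this
          exact ⟨this.1.1.symm, this.2⟩
      · rcases h₁ V G _ hge with ⟨S, hSU, hS⟩ | ⟨S, hSU, hS⟩
        · refine Or.inl ⟨insert v S, insert_subset hv
            (hSU.trans ((filter_subset _ _).trans (erase_subset _ _))), ?_⟩
          exact hS.insert fun b hb => (mem_filter.1 (hSU hb)).2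
        · exact Or.inr ⟨S, hSU.trans ((filter_subset _ _).trans (erase_subset _ _)), hS⟩

/-- Ramsey's theorem makes the defining set nonempty, so the infimum is attained rather than being
the default value `0`. -/
lemma ramseyNum_spec (t m : ℕ) (G : SimpleGraph (Fin (ramseyNum t m))) :
    (∃ S, G.IsNClique t S) ∨ (∃ S, G.IsNIndepSet m S) := by
  have hne : {n : ℕ | ∀ G : SimpleGraph (Fin n),
      (∃ S : Finset (Fin n), G.IsNClique t S) ∨
      (∃ S : Finset (Fin n), G.IsNIndepSet m S)}.Nonempty := by
    obtain ⟨N, hN⟩ := exists_ramsey_bound t m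
    refine ⟨N, fun G => ?_⟩
    rcases hN _ G univ (by simp) with ⟨S, -, hS⟩ | ⟨S, -, hS⟩
    exacts [Or.inl ⟨S, hS⟩, Or.inr ⟨S, hS⟩]
  exact Nat.sInf_mem hne G

/-- If the independence number is below `m`, every set of `R(t, m)` vertices contains `K_t`. -/
lemma exists_isNClique_of_ramseyNum_le {V : Type*} [Finite V] {G : SimpleGraph V} {t m : ℕ}
    (hG : G.indepNum < m) {U : Finset V} (hU : ramseyNum t m ≤ #U) :
    ∃ S ⊆ U, G.IsNClique t S := by
  obtain ⟨e, he⟩ := exists_embedding_mem hU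
  rcases ramseyNum_spec t m (G.comap e) with ⟨S, hS⟩ | ⟨S, hS⟩
  · refine ⟨S.map e, ?_, isNClique_map_of_comap e hS⟩
    intro v hv
    obtain ⟨i, -, rfl⟩ := mem_map.1 hv
    exact he i
  · have := le_indepNum_of_isNIndepSet (isNIndepSet_map_of_comap e hS)
    omega

/-! ### Dependent random choice and its iteration. -/

open Classical in
/-- **Dependent random choice**: a dense relation `R` between `V` and `Y` has a large set
`U ⊆ V` all of whose `p`-subsets have many common neighbours. -/
lemma dependent_random_choice {V Y : Type*} [Fintype V] [Fintype Y] [Nonempty V] [Nonempty Y]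
    (R : V → Y → Prop) (p s : ℕ) {δ η : ℝ} (hδ : 0 < δ) (hη : 0 ≤ η)
    (hR : δ * Fintype.card V * Fintype.card Y ≤ ∑ v, (#{y | R v y} : ℝ))
    (hηs : 2 * (Fintype.card V : ℝ) ^ p * η ^ s ≤ 1) :
    ∃ U : Finset V, δ ^ s * Fintype.card V / 2 ≤ #U ∧
      ∀ S ⊆ U, #S = p → δ * η * Fintype.card Y ≤ #{y | ∀ v ∈ S, R v y} := by
  set n : ℝ := (Fintype.card V : ℝ) with hn
  set m : ℝ := (Fintype.card Y : ℝ) with hm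
  have hn0 : 0 < n := by rw [hn]; exact_mod_cast Fintype.card_pos
  have hm0 : 0 < m := by rw [hm]; exact_mod_cast Fintype.card_pos
  -- `f` is a sample of `s` elements of `Y`, repetitions allowed. A `p`-set is in `B` if it has too
  -- few common neighbours; `bad f` counts those inside `U f`.
  let U : (Fin s → Y) → Finset V := fun f => {v | ∀ i, R v (f i)}
  let B : Finset (Finset V) :=
    (powersetCard p univ).filter fun S => (#{y | ∀ v ∈ S, R v y} : ℝ) < δ * η * m
  let bad : (Fin s → Y) → ℕ := fun f => #(B.filter (fun S => S ⊆ U f))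
  have hpow : ∀ (P : Y → Prop) [DecidablePred P],
      #{f : Fin s → Y | ∀ i, P (f i)} = #{y | P y} ^ s := by
    intro P _
    have : ({f : Fin s → Y | ∀ i, P (f i)} : Finset (Fin s → Y)) =
        Fintype.piFinset fun _ => ({y | P y} : Finset Y) := by
      ext f; simp [Fintype.mem_piFinset]
    rw [this, Fintype.card_piFinset]; simp
  have hU : ∑ f, (#(U f) : ℝ) = ∑ v, (#{y | R v y} : ℝ) ^ s := by
    have : ∑ f, #(U f) = ∑ v, #{y | R v y} ^ s := by
      rw [sum_congr rfl fun v _ => (hpow (R v)).symm]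
      simp_rw [U, card_filter]
      exact sum_comm
    exact_mod_cast this
  have hbad : ∑ f, (bad f : ℝ) = ∑ S ∈ B, (#{y | ∀ v ∈ S, R v y} : ℝ) ^ s := by
    have : ∑ f, bad f = ∑ S ∈ B, #{y | ∀ v ∈ S, R v y} ^ s := by
      rw [sum_congr rfl fun S _ => (hpow (fun y => ∀ v ∈ S, R v y)).symm]
      simp_rw [bad, card_filter]
      rw [sum_comm]
      refine sum_congr rfl fun S _ => sum_congr rfl fun f _ => ?_
      congr 1
      simp only [U, subset_iff, mem_filter, mem_univ, true_and, eq_iff_iff]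
      exact ⟨fun h i v hv => h hv i, fun h v hv i => h i v hv⟩
    exact_mod_cast this
  have hU' : n * (δ * m) ^ s ≤ ∑ f, (#(U f) : ℝ) := by
    rw [hU]
    rcases Nat.eq_zero_or_pos s with rfl | hs
    · simp [hn]
    obtain ⟨k, rfl⟩ : ∃ k, s = k + 1 := ⟨s - 1, by omega⟩
    -- Convexity of the `s`-th power, summed over `V`.
    have h := pow_sum_div_card_le_sum_pow (s := (univ : Finset V))
      (f := fun v => (#{y | R v y} : ℝ)) (fun _ _ => by positivity) k
    refine le_trans ?_ h
    rw [card_univ, ← hn, le_div_iff₀ (by positivity)]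
    calc n * (δ * m) ^ (k + 1) * n ^ k = (δ * n * m) ^ (k + 1) := by ring
      _ ≤ _ := pow_le_pow_left₀ (by positivity) hR _
  have hbad' : ∑ f, (bad f : ℝ) ≤ n ^ p * (δ * η * m) ^ s := by
    rw [hbad]
    calc _ ≤ ∑ S ∈ B, (δ * η * m) ^ s := by
          refine sum_le_sum fun S hS => pow_le_pow_left₀ (by positivity) ?_ _
          exact (mem_filter.1 hS).2.le
      _ = #B * (δ * η * m) ^ s := by rw [sum_const, nsmul_eq_mul]
      _ ≤ _ := by
          refine mul_le_mul_of_nonneg_right ?_ (by positivity)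
          have h1 : #B ≤ Fintype.card V ^ p := by
            refine (card_filter_le _ _).trans ?_
            rw [card_powersetCard, card_univ]
            exact Nat.choose_le_pow _ _
          rw [hn]; exact_mod_cast h1
  -- The weight `n` on bad sets means that a sample with even one of them contributes at most `0`. A
  -- sample reaching the average therefore has none, and no vertices need be deleted.
  have hsum : ∑ _f : Fin s → Y, δ ^ s * n / 2 ≤ ∑ f, ((#(U f) : ℝ) - n * bad f) := by
    rw [sum_sub_distrib, ← mul_sum, sum_const, card_univ, nsmul_eq_mul]
    simp only [Fintype.card_fun, Fintype.card_fin, Nat.cast_pow]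
    rw [← hm]
    have h3 : n ^ p * (δ * η * m) ^ s * 2 ≤ (δ * m) ^ s := by
      calc n ^ p * (δ * η * m) ^ s * 2 = (2 * n ^ p * η ^ s) * (δ * m) ^ s := by
            rw [mul_pow, mul_pow, mul_pow]; ring
        _ ≤ 1 * (δ * m) ^ s := mul_le_mul_of_nonneg_right hηs (by positivity)
        _ = _ := one_mul _
    have h4 : n * ∑ f, (bad f : ℝ) ≤ n * ((δ * m) ^ s / 2) :=
      mul_le_mul_of_nonneg_left (by linarith) hn0.le
    have h5 : m ^ s * (δ ^ s * n / 2) = n * (δ * m) ^ s / 2 := by rw [mul_pow]; ring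
    rw [h5]; linarith
  obtain ⟨f, -, hf⟩ := exists_le_of_sum_le (univ_nonempty) hsum
  have hpos : 0 < δ ^ s * n / 2 := by positivity
  have hbf : bad f = 0 := by
    by_contra hne
    have h1 : (1 : ℝ) ≤ bad f := by exact_mod_cast Nat.one_le_iff_ne_zero.2 hne
    have h2 : (#(U f) : ℝ) ≤ n := by rw [hn]; exact_mod_cast card_le_univ _
    nlinarith
  refine ⟨U f, by rw [hbf] at hf; simpa using hf, fun S hSU hSp => ?_⟩
  by_contra hlt
  rw [not_le] at hlt
  have : S ∈ B.filter (fun S => S ⊆ U f) := by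
    simp only [B, mem_filter, mem_powersetCard, subset_univ, true_and]
    exact ⟨⟨hSp, hlt⟩, hSU⟩
  exact (card_pos.2 ⟨S, this⟩).ne' hbf

open Classical in
lemma card_eq_sum_card_cons {V : Type*} [Fintype V] {r : ℕ} (T : Finset (Fin (r + 1) → V)) :
    #T = ∑ v, #{y : Fin r → V | (Fin.cons v y : Fin (r + 1) → V) ∈ T} := by
  simp_rw [card_filter]
  rw [← Fintype.sum_prod_type' (f := fun (v : V) (y : Fin r → V) =>
    if (Fin.cons v y : Fin (r + 1) → V) ∈ T then 1 else 0)]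
  refine Eq.trans ?_ (Fintype.sum_equiv (Fin.consEquiv (fun _ : Fin (r + 1) => V)) _
      (fun z => if z ∈ T then 1 else 0) (fun _ => rfl)).symm
  simp

open Classical in
/-- Iterated dependent random choice. If large vertex sets contain `K_p` and even rather small
ones contain `K_k`, then a dense family of ordered cliques of length `r + 1` yields a clique
on `p * r + k` vertices. -/
lemma exists_isNClique_of_dense_tuples {V : Type*} [Fintype V] [Nonempty V] {G : SimpleGraph V}
    {p k : ℕ} (hp : 0 < p) {F F' : ℝ} (hF : ∀ U : Finset V, F ≤ #U → ∃ S ⊆ U, G.IsNClique p S)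
    (hF' : ∀ U : Finset V, F' ≤ #U → ∃ S ⊆ U, G.IsNClique k S)
    (δ : ℕ → ℝ) (s : ℕ → ℕ) (hδ : ∀ j, 0 < δ j) (hδ0 : F' ≤ δ 0 * Fintype.card V)
    (r : ℕ) (hFδ : ∀ j < r, F ≤ δ (j + 1) ^ s j * Fintype.card V / 2)
    (hδs : ∀ j < r, 2 * (Fintype.card V : ℝ) ^ p * (δ j / δ (j + 1)) ^ s j ≤ 1)
    (T : Finset (Fin (r + 1) → V)) (hT : ∀ y ∈ T, ∀ i j, i ≠ j → G.Adj (y i) (y j))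
    (hcard : δ r * (Fintype.card V : ℝ) ^ (r + 1) ≤ #T) :
    ∃ C : Finset V, G.IsNClique (p * r + k) C ∧ ∀ c ∈ C, ∃ y ∈ T, ∃ i, y i = c := by
  -- The second conclusion, that `C` consists of coordinates of tuples in `T`, is what lets the
  -- `K_p` of a round be joined to the clique from later rounds.
  induction r with
  | zero =>
    have h1 : #(T.image fun y => y 0) = #T := by
      refine card_image_of_injective _ fun y z h => ?_
      funext i
      rw [Fin.eq_zero i]; exact h
    obtain ⟨S, hS, hSc⟩ := hF' (T.image fun y => y 0) (by
      rw [h1]; refine hδ0.trans ?_; simpa using hcard)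
    refine ⟨S, by simpa using hSc, fun c hc => ?_⟩
    obtain ⟨y, hy, hyc⟩ := mem_image.1 (hS hc)
    exact ⟨y, hy, 0, hyc⟩
  | succ r ih =>
    obtain ⟨R, hRT⟩ : ∃ R : V → (Fin (r + 1) → V) → Prop,
        ∀ v y, R v y ↔ (Fin.cons v y : Fin (r + 2) → V) ∈ T := ⟨_, fun _ _ => Iff.rfl⟩
    have hR : δ (r + 1) * Fintype.card V * Fintype.card (Fin (r + 1) → V)
        ≤ ∑ v, (#{y | R v y} : ℝ) := by
      have h1 : (#T : ℝ) = ∑ v, (#{y | R v y} : ℝ) := by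
        rw [card_eq_sum_card_cons T]
        simp only [← hRT]
        push_cast
        rfl
      rw [← h1]
      refine le_of_eq_of_le ?_ hcard
      simp only [Fintype.card_fun, Fintype.card_fin, Nat.cast_pow]
      ring
    -- With `η = δ r / δ (r + 1)` the guaranteed common density `δ (r + 1) * η` is `δ r`, as the
    -- induction hypothesis demands.
    obtain ⟨U, hU, hUS⟩ := dependent_random_choice R p (s r) (hδ (r + 1))
      (div_pos (hδ r) (hδ (r + 1))).le hR (hδs r (Nat.lt_succ_self r))
    obtain ⟨S, hSU, hS⟩ := hF U ((hFδ r (Nat.lt_succ_self r)).trans hU)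
    obtain ⟨v, hv⟩ : S.Nonempty := card_pos.1 (by rw [hS.2]; exact hp)
    have hcod := hUS S hSU hS.2
    rw [mul_div_cancel₀ _ (hδ (r + 1)).ne'] at hcod
    obtain ⟨C, hC, hCT⟩ := ih (fun j hj => hFδ j (by omega)) (fun j hj => hδs j (by omega))
      ({y | ∀ v ∈ S, R v y} : Finset (Fin (r + 1) → V))
      (by
        intro y hy i j hij
        have h1 := hT _ ((hRT _ _).1 ((mem_filter.1 hy).2 v hv)) i.succ j.succ
          (fun h => hij (Fin.succ_injective _ h))
        simpa using h1)
      (by simpa using hcod)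
    have hadj : ∀ v ∈ S, ∀ c ∈ C, G.Adj v c := by
      intro v hv c hc
      obtain ⟨y, hy, i, rfl⟩ := hCT c hc
      have h1 := hT _ ((hRT _ _).1 ((mem_filter.1 hy).2 v hv)) 0 i.succ (Fin.succ_ne_zero i).symm
      simpa using h1
    have hdisj : Disjoint S C := by
      rw [disjoint_left]
      intro v hv hc
      exact G.loopless.irrefl v (hadj v hv v hc)
    refine ⟨S ∪ C, ⟨?_, ?_⟩, ?_⟩
    · intro a ha b hb hab
      rw [mem_coe, mem_union] at ha hb
      rcases ha with ha | ha <;> rcases hb with hb | hb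
      · exact hS.1 ha hb hab
      · exact hadj a ha b hb
      · exact (hadj b hb a ha).symm
      · exact hC.1 ha hb hab
    · rw [card_union_of_disjoint hdisj, hS.2, hC.2]; ring
    · intro c hc
      rcases mem_union.1 hc with hc | hc
      · have hpos : 0 < #{y : Fin (r + 1) → V | ∀ v ∈ S, R v y} := by
          have h1 : 0 < δ r * (Fintype.card (Fin (r + 1) → V) : ℝ) :=
            mul_pos (hδ r) (by exact_mod_cast Fintype.card_pos)
          exact_mod_cast h1.trans_le hcod
        obtain ⟨y, hy⟩ := card_pos.1 hpos
        exact ⟨_, (hRT _ _).1 ((mem_filter.1 hy).2 c hc), 0, by simp⟩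
      · obtain ⟨y, hy, i, rfl⟩ := hCT c hc
        exact ⟨_, (hRT _ _).1 ((mem_filter.1 hy).2 v hv), i.succ, by simp⟩

/-! ### Supersaturation. -/

open Classical in
/-- A dense graph has a large vertex set `W` inducing a subgraph of large minimum degree. -/
lemma exists_subset_le_degree {V : Type*} [Fintype V] (G : SimpleGraph V) {lam ε : ℝ}
    (hlam : 0 ≤ lam) (hG : (lam + ε) * (Fintype.card V : ℝ) ^ 2 ≤ ∑ v, (#{w | G.Adj v w} : ℝ)) :
    ∃ W : Finset V, ε * (Fintype.card V : ℝ) ^ 2 ≤ (#W : ℝ) ^ 2 ∧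
      ∀ v ∈ W, lam * #W - lam / 2 ≤ #(W.filter (G.Adj v)) := by
  let e : Finset V → ℝ := fun W => ∑ v ∈ W, (#(W.filter (G.Adj v)) : ℝ)
  -- `e` counts each edge twice. Comparing the maximiser `W` with the whole vertex set bounds its
  -- size; comparing it with `W.erase v` bounds the degree of `v`, as `2 * deg ≥ lam * (2 * #W -
  -- 1)`.
  obtain ⟨W, -, hW⟩ := exists_max_image (univ : Finset (Finset V))
    (fun W => e W - lam * (#W : ℝ) ^ 2) univ_nonempty
  refine ⟨W, ?_, fun v hv => ?_⟩
  · have h1 := hW univ (mem_univ _)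
    have h2 : e W ≤ (#W : ℝ) ^ 2 := by
      calc e W ≤ ∑ v ∈ W, (#W : ℝ) := sum_le_sum fun v _ => by exact_mod_cast card_filter_le _ _
        _ = _ := by rw [sum_const, nsmul_eq_mul, sq]
    have h3 : 0 ≤ lam * (#W : ℝ) ^ 2 := by positivity
    simp only [e, card_univ] at h1 h2
    linarith
  · have h1 := hW (W.erase v) (mem_univ _)
    have h2 : e W = e (W.erase v) + 2 * #(W.filter (G.Adj v)) := by
      have h3 : ∀ u ∈ W.erase v, (#(W.filter (G.Adj u)) : ℝ) =
          #((W.erase v).filter (G.Adj u)) + if G.Adj v u then 1 else 0 := by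
        intro u hu
        rw [filter_erase]
        split_ifs with h
        · have : v ∈ W.filter (G.Adj u) := mem_filter.2 ⟨hv, h.symm⟩
          rw [← card_erase_add_one this]; push_cast; rfl
        · rw [erase_eq_of_notMem (fun hm => h (mem_filter.1 hm).2.symm)]; simp
      have h4 : (#(W.filter (G.Adj v)) : ℝ) = ∑ u ∈ W.erase v, if G.Adj v u then 1 else 0 := by
        rw [sum_erase _ (by simp), sum_boole]
      simp only [e]
      rw [← add_sum_erase _ _ hv, sum_congr rfl h3, sum_add_distrib, ← h4]
      ring
    have h5 : (#(W.erase v) : ℝ) = #W - 1 := by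
      rw [card_erase_of_mem hv, Nat.cast_sub (card_pos.2 ⟨v, hv⟩)]; simp
    simp only [h5] at h1
    rw [h2] at h1
    nlinarith

open Classical in
/-- Ordered cliques of length `r` inside a set `W` of large minimum degree are numerous. -/
lemma le_card_clique_tuples {V : Type*} [Fintype V] (G : SimpleGraph V) {W : Finset V}
    {μ β : ℝ} (hβ : 0 ≤ β) (hW : ∀ v ∈ W, (#W : ℝ) - μ ≤ #(W.filter (G.Adj v))) (r : ℕ)
    (hμ : ∀ k < r, β ≤ #W - k * μ) :
    β ^ r ≤ #{y : Fin r → V | (∀ i, y i ∈ W) ∧ ∀ i j, i ≠ j → G.Adj (y i) (y j)} := by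
  induction r with
  | zero => simp
  | succ r ih =>
    specialize ih fun k hk => hμ k (by omega)
    set T : Finset (Fin r → V) := {y | (∀ i, y i ∈ W) ∧ ∀ i j, i ≠ j → G.Adj (y i) (y j)}
    -- Greedy extension: each of the `r` vertices already chosen excludes at most `μ` vertices of
    -- `W`.
    let nbrs : (Fin r → V) → Finset V := fun y => W.filter fun w => ∀ i, G.Adj w (y i)
    have hnbrs : ∀ y ∈ T, β ≤ #(nbrs y) := by
      intro y hy
      have hyW := (mem_filter.1 hy).2.1
      have h1 : W ⊆ nbrs y ∪ univ.biUnion fun i => W.filter fun w => ¬ G.Adj (y i) w := by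
        intro w hw
        by_cases h : ∀ i, G.Adj w (y i)
        · exact mem_union_left _ (mem_filter.2 ⟨hw, h⟩)
        · push Not at h
          obtain ⟨i, hi⟩ := h
          exact mem_union_right _ (mem_biUnion.2 ⟨i, mem_univ _,
            mem_filter.2 ⟨hw, fun h => hi h.symm⟩⟩)
      have h2 : (#W : ℝ) ≤ #(nbrs y) + ∑ i : Fin r, (#(W.filter fun w => ¬ G.Adj (y i) w) : ℝ) := by
        have := (card_le_card h1).trans ((card_union_le _ _).trans
          (Nat.add_le_add_left card_biUnion_le _))
        exact_mod_cast this
      have h3 : ∀ i : Fin r, (#(W.filter fun w => ¬ G.Adj (y i) w) : ℝ) ≤ μ := by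
        intro i
        have h4 := hW _ (hyW i)
        have h5 : (#(W.filter (G.Adj (y i))) : ℝ) + #(W.filter fun w => ¬ G.Adj (y i) w) = #W := by
          exact_mod_cast card_filter_add_card_filter_not _
        linarith
      have h6 := sum_le_sum fun i (_ : i ∈ (univ : Finset (Fin r))) => h3 i
      rw [sum_const, card_univ, Fintype.card_fin, nsmul_eq_mul] at h6
      have := hμ r (Nat.lt_succ_self r)
      linarith
    have hmap : (T.sigma nbrs).card ≤
        #{y : Fin (r + 1) → V | (∀ i, y i ∈ W) ∧ ∀ i j, i ≠ j → G.Adj (y i) (y j)} := by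
      refine card_le_card_of_injOn (fun z => Fin.cons z.2 z.1) ?_ ?_
      · rintro ⟨y, w⟩ hz
        simp only [coe_sigma, Set.mem_sigma_iff, mem_coe, T, nbrs, mem_filter, mem_univ,
          true_and] at hz
        simp only [coe_filter, mem_univ, true_and, Set.mem_ofPred_eq]
        refine ⟨fun i => ?_, fun i j hij => ?_⟩
        · cases i using Fin.cases with
          | zero => simpa using hz.2.1
          | succ i => simpa using hz.1.1 i
        · cases i using Fin.cases with
          | zero =>
            cases j using Fin.cases with
            | zero => exact absurd rfl hij
            | succ j => simpa using hz.2.2 j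
          | succ i =>
            cases j using Fin.cases with
            | zero => simpa using (hz.2.2 i).symm
            | succ j => simpa using hz.1.2 i j (fun h => hij (by rw [h]))
      · rintro ⟨y, w⟩ - ⟨y', w'⟩ - h
        obtain ⟨h1, h2⟩ := Fin.cons_injective2 h
        subst h1; subst h2; rfl
    calc β ^ (r + 1) = β ^ r * β := pow_succ _ _
      _ ≤ #T * β := mul_le_mul_of_nonneg_right ih hβ
      _ = ∑ y ∈ T, β := by rw [sum_const, nsmul_eq_mul]
      _ ≤ ∑ y ∈ T, (#(nbrs y) : ℝ) := sum_le_sum hnbrs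
      _ = ((T.sigma nbrs).card : ℝ) := by rw [card_sigma]; push_cast; rfl
      _ ≤ _ := by exact_mod_cast hmap

open Classical in
/-- **Supersaturation**: graphs of edge density beyond the Turán density of `K_{r+1}` contain a
positive proportion of all possible ordered cliques of length `r + 1`. -/
lemma supersaturation {r : ℕ} (hr : 1 ≤ r) {ε : ℝ} (hε : 0 < ε) (hε1 : ε ≤ 1) :
    ∃ c : ℝ, 0 < c ∧ c ≤ 1 ∧ ∀ᶠ n : ℕ in atTop, ∀ G : SimpleGraph (Fin n),
      ((1 - 1 / (r : ℝ)) + 2 * ε) * (n : ℝ) ^ 2 ≤ ∑ v, (#{w | G.Adj v w} : ℝ) →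
      c * (n : ℝ) ^ (r + 1) ≤
        #{y : Fin (r + 1) → Fin n | ∀ i j, i ≠ j → G.Adj (y i) (y j)} := by
  refine ⟨(ε * ε / 2) ^ (r + 1), by positivity, ?_, ?_⟩
  · exact pow_le_one₀ (by positivity) (by nlinarith)
  obtain ⟨N, hN⟩ := exists_nat_ge (2 / (ε * ε))
  filter_upwards [eventually_ge_atTop N] with n hn G hG
  have hr0 : (1 : ℝ) ≤ r := by exact_mod_cast hr
  have hinv : 1 / (r : ℝ) ≤ 1 := by rw [div_le_one (by linarith)]; exact hr0
  have hinv0 : 0 < 1 / (r : ℝ) := by positivity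
  obtain ⟨W, hW, hdeg⟩ := exists_subset_le_degree G (lam := 1 - 1 / (r : ℝ) + ε) (ε := ε)
    (by linarith) (by rw [Fintype.card_fin]; convert hG using 2; ring)
  rw [Fintype.card_fin] at hW
  have hWn : ε * n ≤ #W := by
    refine abs_le_of_sq_le_sq' ?_ (by positivity) |>.2
    refine le_trans ?_ hW
    nlinarith [mul_nonneg (mul_nonneg hε.le (sub_nonneg.2 hε1)) (sq_nonneg (n : ℝ))]
  have hεW : 2 ≤ ε * #W := by
    have h1 : 2 / (ε * ε) ≤ n := hN.trans (by exact_mod_cast hn)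
    rw [div_le_iff₀ (by positivity)] at h1
    nlinarith
  have hβ : ε * ε / 2 * n ≤ ε / 2 * #W := by nlinarith
  have hrμ : (r : ℝ) * (1 / r) = 1 := by field_simp
  -- Half of the surplus `ε * #W` in the degrees absorbs the error `lam / 2 ≤ 1`, since `ε * #W ≥
  -- 2`. The other half leaves at least `ε / 2 * #W` choices for every coordinate.
  have key := le_card_clique_tuples G (W := W) (μ := (1 / (r : ℝ) - ε / 2) * #W)
    (β := ε / 2 * #W) (by positivity) (fun v hv => by
      have h1 := hdeg v hv
      have h2 : 1 - 1 / (r : ℝ) + ε ≤ 2 := by linarith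
      nlinarith) (r + 1) (fun k hk => by
      have hk' : (k : ℝ) ≤ r := by exact_mod_cast Nat.lt_succ_iff.1 hk
      have hW0 : (0 : ℝ) ≤ #W := by positivity
      rcases Nat.eq_zero_or_pos k with rfl | hk0
      · simp; nlinarith
      · have hk1 : (1 : ℝ) ≤ k := by exact_mod_cast hk0
        have h3 : (k : ℝ) * (1 / r) ≤ 1 :=
          (mul_le_mul_of_nonneg_right hk' hinv0.le).trans hrμ.le
        have h4 : ε / 2 ≤ 1 - k * (1 / (r : ℝ) - ε / 2) := by nlinarith
        calc ε / 2 * #W ≤ (1 - k * (1 / (r : ℝ) - ε / 2)) * #W :=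
              mul_le_mul_of_nonneg_right h4 hW0
          _ = _ := by ring)
  calc (ε * ε / 2) ^ (r + 1) * (n : ℝ) ^ (r + 1) = (ε * ε / 2 * n) ^ (r + 1) := by ring
    _ ≤ (ε / 2 * #W) ^ (r + 1) := pow_le_pow_left₀ (by positivity) hβ _
    _ ≤ _ := key
    _ ≤ _ := by
      refine Nat.cast_le.2 (card_le_card fun y hy => ?_)
      simp only [mem_filter, mem_univ, true_and] at hy ⊢
      exact hy.2

/-! ### Choice of parameters and the forced clique. -/

/-- Exponents `a j` and sample sizes `s j` for the iterated dependent random choice. -/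
lemma exists_parameters (p : ℕ) {r : ℕ} (hr : 1 ≤ r) {A ϑ : ℝ} (hA : 0 < A) (hϑ : 0 < ϑ) :
    ∃ C x₀ : ℝ, ∀ x, x₀ ≤ x → ∃ (a : ℕ → ℝ) (s : ℕ → ℕ), a r = A ∧ a 0 ≤ ϑ * x ^ r ∧
      (∀ j < r, s j * a (j + 1) + 1 ≤ C * x ^ (r - 1)) ∧
      (∀ j < r, 1 + p * x ^ r ≤ s j * (a j - a (j + 1))) := by
  obtain ⟨κ, hκ, hκ1, hκA⟩ : ∃ κ : ℝ, 0 < κ ∧ κ ≤ 1 ∧ A * κ ≤ ϑ := by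
    refine ⟨min 1 (ϑ / A), by positivity, min_le_left _ _, ?_⟩
    calc A * min 1 (ϑ / A) ≤ A * (ϑ / A) := mul_le_mul_of_nonneg_left (min_le_right _ _) hA.le
      _ = ϑ := by field_simp
  refine ⟨2 * (p + 1) / κ + A + 1, 2 / κ, fun x hx => ?_⟩
  have hκx : 2 ≤ κ * x := by rw [div_le_iff₀ hκ] at hx; linarith
  have hx1 : 1 ≤ x := by nlinarith
  have hx0 : 0 < x := by linarith
  have hκx0 : 0 < κ * x := by linarith
  -- Here `x ^ r` will be `log n`. As `κ * x ≥ 2`, `a j - a (j + 1)` is at least `a j / 2`, so `s j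
  -- ≈ 2 (p + 1) x ^ r / a j` suffices for the last condition. Then `s j * a (j + 1)` is of order `x
  -- ^ r / (κ * x)`, that is `x ^ (r - 1)`.
  refine ⟨fun j => A * (κ * x) ^ (r - j),
    fun j => ⌈2 * (p + 1) * x ^ r / (A * (κ * x) ^ (r - j))⌉₊, by simp, ?_, ?_, ?_⟩
  · have h1 : κ ^ r ≤ κ := by
      obtain ⟨k, rfl⟩ : ∃ k, r = k + 1 := ⟨r - 1, by omega⟩
      rw [pow_succ]
      exact mul_le_of_le_one_left hκ.le (pow_le_one₀ hκ.le hκ1)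
    simp only [Nat.sub_zero, mul_pow]
    rw [← mul_assoc]
    exact mul_le_mul_of_nonneg_right ((mul_le_mul_of_nonneg_left h1 hA.le).trans hκA)
      (by positivity)
  · intro j hj
    obtain ⟨i, rfl⟩ : ∃ i, r = j + 1 + i := ⟨r - (j + 1), by omega⟩
    have e1 : j + 1 + i - j = i + 1 := by omega
    have e2 : j + 1 + i - (j + 1) = i := by omega
    have e3 : j + 1 + i - 1 = j + i := by omega
    simp only [e1, e2, e3]
    set D : ℝ := 2 * (p + 1) * x ^ (j + 1 + i) / (A * (κ * x) ^ (i + 1)) with hD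
    have hD0 : 0 ≤ D := by positivity
    have h1 : (⌈D⌉₊ : ℝ) ≤ D + 1 := (Nat.ceil_lt_add_one hD0).le
    have h2 : D * (A * (κ * x) ^ i) = 2 * (p + 1) / κ * x ^ (j + i) := by
      rw [hD]; field_simp; ring
    have h3 : (κ * x) ^ i ≤ x ^ (j + i) := by
      calc (κ * x) ^ i ≤ x ^ i := pow_le_pow_left₀ hκx0.le (by nlinarith) _
        _ ≤ x ^ (j + i) := pow_le_pow_right₀ hx1 (by omega)
    have h4 : 1 ≤ x ^ (j + i) := one_le_pow₀ hx1
    have h5 : (⌈D⌉₊ : ℝ) * (A * (κ * x) ^ i) ≤ (D + 1) * (A * (κ * x) ^ i) :=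
      mul_le_mul_of_nonneg_right h1 (by positivity)
    have h6 : A * (κ * x) ^ i ≤ A * x ^ (j + i) := mul_le_mul_of_nonneg_left h3 hA.le
    linarith
  · intro j hj
    obtain ⟨i, rfl⟩ : ∃ i, r = j + 1 + i := ⟨r - (j + 1), by omega⟩
    have e1 : j + 1 + i - j = i + 1 := by omega
    have e2 : j + 1 + i - (j + 1) = i := by omega
    simp only [e1, e2]
    set D : ℝ := 2 * (p + 1) * x ^ (j + 1 + i) / (A * (κ * x) ^ (i + 1)) with hD
    have hD0 : 0 ≤ D := by positivity
    have h1 : A * (κ * x) ^ (i + 1) / 2 ≤ A * (κ * x) ^ (i + 1) - A * (κ * x) ^ i := by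
      have : 0 < A * (κ * x) ^ i := by positivity
      rw [pow_succ]; nlinarith
    have h2 : D * (A * (κ * x) ^ (i + 1) / 2) = (p + 1) * x ^ (j + 1 + i) := by
      rw [hD]; field_simp
    have h3 : 1 ≤ x ^ (j + 1 + i) := one_le_pow₀ hx1
    calc 1 + p * x ^ (j + 1 + i) ≤ (p + 1) * x ^ (j + 1 + i) := by linarith
      _ = D * (A * (κ * x) ^ (i + 1) / 2) := h2.symm
      _ ≤ ⌈D⌉₊ * (A * (κ * x) ^ (i + 1) - A * (κ * x) ^ i) :=
        mul_le_mul (Nat.le_ceil _) h1 (by positivity) (by positivity)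

open Classical in
/-- Graphs of density beyond `1 - 1 / (q - 1)` whose independence number is below `Q(p, f(n))`
contain `K_{pq-1}`. -/
theorem eventually_not_cliqueFree {p q : ℕ} (hp : 3 ≤ p) (hq : 2 ≤ q) {ω : ℕ → ℝ}
    (hω : Tendsto ω atTop atTop) (hgap : RamseyGap p (fFun q ω)) {ε : ℝ} (hε : 0 < ε)
    (hε1 : ε ≤ 1) :
    ∀ᶠ n : ℕ in atTop, ∀ G : SimpleGraph (Fin n), G.indepNum < invRamsey p (fFun q ω n) →
      ((1 - 1 / ((q : ℝ) - 1)) + 2 * ε) * (n : ℝ) ^ 2 ≤ ∑ v, (#{w | G.Adj v w} : ℝ) →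
      ¬ G.CliqueFree (p * q - 1) := by
  obtain ⟨r, rfl⟩ : ∃ r, q = r + 1 := ⟨q - 1, by omega⟩
  have hr : 1 ≤ r := by omega
  have hr0 : (0 : ℝ) < r := by exact_mod_cast hr
  have hqr : (((r + 1 : ℕ) : ℝ) - 1) = r := by push_cast; ring
  rw [hqr]
  obtain ⟨c, hc, hc1, hsat⟩ := supersaturation hr hε hε1
  obtain ⟨ϑ, hϑ, hgap⟩ := hgap
  obtain ⟨A, hA, hAc⟩ : ∃ A : ℝ, 0 < A ∧ (2 : ℝ) ^ (-A) ≤ c := by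
    -- The summand `1` keeps `A` positive when `c = 1`.
    refine ⟨1 + -Real.logb 2 c, ?_, ?_⟩
    · have := Real.logb_nonpos (b := 2) (by norm_num) hc.le hc1
      linarith
    · calc (2 : ℝ) ^ (-(1 + -Real.logb 2 c)) ≤ 2 ^ (Real.logb 2 c) :=
            Real.rpow_le_rpow_of_exponent_le (by norm_num) (by linarith)
        _ = c := Real.rpow_logb (by norm_num) (by norm_num) hc
  obtain ⟨C, x₀, hpar⟩ := exists_parameters p hr hA hϑ
  have hlog : Tendsto (fun n : ℕ => Real.logb 2 (n : ℝ)) atTop atTop :=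
    (Real.tendsto_logb_atTop (by norm_num)).comp tendsto_natCast_atTop_atTop
  have hx : Tendsto (fun n : ℕ => Real.logb 2 (n : ℝ) ^ (1 / (r : ℝ))) atTop atTop :=
    (tendsto_rpow_atTop (by positivity)).comp hlog
  filter_upwards [hsat, hgap, hω.eventually_ge_atTop C, hx.eventually_ge_atTop x₀,
    hlog.eventually_ge_atTop 0, eventually_ge_atTop 1] with n hsat hgap hωn hxn hL hn G hα hG hfree
  have : Nonempty (Fin n) := ⟨⟨0, by omega⟩⟩
  have hn0 : (0 : ℝ) < n := by exact_mod_cast hn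
  set L := Real.logb 2 (n : ℝ) with hLdef
  set x := L ^ (1 / (r : ℝ)) with hxdef
  have hx0 : 0 ≤ x := Real.rpow_nonneg hL _
  have hnL : (n : ℝ) = 2 ^ L := (Real.rpow_logb (by norm_num) (by norm_num) hn0).symm
  have hxr : x ^ r = L := by
    rw [hxdef, ← Real.rpow_natCast, ← Real.rpow_mul hL, one_div_mul_cancel hr0.ne', Real.rpow_one]
  have hxr1 : L ^ ((((r + 1 : ℕ) : ℝ) - 2) / (((r + 1 : ℕ) : ℝ) - 1)) = x ^ (r - 1) := by
    rw [hxdef, ← Real.rpow_natCast, ← Real.rpow_mul hL, hqr, Nat.cast_sub hr]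
    congr 1
    push_cast
    field_simp
    ring
  obtain ⟨a, s, har, ha0, has, has'⟩ := hpar x hxn
  rw [hxr] at ha0
  obtain ⟨K, hK, -⟩ := exists_isNClique_of_dense_tuples (V := Fin n) (G := G) (p := p) (k := p - 1)
    (by omega) (F := fFun (r + 1) ω n) (F' := (n : ℝ) ^ (1 - ϑ))
    (fun U hU => exists_isNClique_of_indepNum_lt_invRamsey hα hU)
    (fun U hU => exists_isNClique_of_ramseyNum_le hα (by exact_mod_cast (hgap.le.trans hU)))
    (fun j => (2 : ℝ) ^ (-a j)) s (fun j => by positivity)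
    (by
      rw [Fintype.card_fin, Real.rpow_sub hn0, Real.rpow_one, div_eq_mul_inv, mul_comm]
      refine mul_le_mul_of_nonneg_right ?_ hn0.le
      rw [← Real.rpow_neg hn0.le]
      nth_rewrite 1 [hnL]
      rw [← Real.rpow_mul (by norm_num)]
      exact Real.rpow_le_rpow_of_exponent_le (by norm_num) (by linarith))
    r
    (by
      intro j hj
      -- The `+ 1` in `has` pays for the division by `2`; `ω n ≥ C` does the rest.
      rw [Fintype.card_fin, fFun, ← hLdef, hxr1, mul_comm, mul_div_right_comm]
      refine mul_le_mul_of_nonneg_right ?_ hn0.le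
      rw [← Real.rpow_natCast (2 ^ (-a (j + 1))), ← Real.rpow_mul (by norm_num),
        ← Real.rpow_sub_one (by norm_num)]
      refine Real.rpow_le_rpow_of_exponent_le (by norm_num) ?_
      have h1 := has j hj
      have h2 : C * x ^ (r - 1) ≤ ω n * x ^ (r - 1) :=
        mul_le_mul_of_nonneg_right hωn (by positivity)
      linarith)
    (by
      intro j hj
      have h1 := has' j hj
      rw [hxr] at h1
      have h2 : 2 * (n : ℝ) ^ p * ((2 : ℝ) ^ (-a j) / 2 ^ (-a (j + 1))) ^ s j =
          2 ^ (1 + L * p + (-a j - -a (j + 1)) * s j) := by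
        rw [← Real.rpow_sub (by norm_num), Real.rpow_add (by norm_num),
          Real.rpow_add (by norm_num), Real.rpow_one, Real.rpow_mul (by norm_num),
          Real.rpow_mul (by norm_num), ← hnL, Real.rpow_natCast, Real.rpow_natCast]
      rw [Fintype.card_fin, h2]
      exact Real.rpow_le_one_of_one_le_of_nonpos (by norm_num) (by linarith))
    {y | ∀ i j, i ≠ j → G.Adj (y i) (y j)} (fun y hy => (mem_filter.1 hy).2)
    (by
      rw [Fintype.card_fin, har]
      refine le_trans ?_ (hsat G hG)
      exact mul_le_mul_of_nonneg_right hAc (by positivity))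
  refine hK.not_cliqueFree (?_ : G.CliqueFree _)
  have : p * r + (p - 1) = p * (r + 1) - 1 := by rw [mul_add]; omega
  rwa [this]

/-! ### Edge counts and bounds on `rtNum`. -/

open Classical in
lemma two_mul_ncard_edgeSet {V : Type*} [Fintype V] (G : SimpleGraph V) :
    2 * G.edgeSet.ncard = ∑ v, #{w | G.Adj v w} := by
  rw [← SimpleGraph.coe_edgeFinset, Set.ncard_coe_finset, ← G.sum_degrees_eq_twice_card_edges]
  refine sum_congr rfl fun v _ => ?_
  rw [← SimpleGraph.card_neighborFinset_eq_degree, SimpleGraph.neighborFinset_eq_filter]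

lemma two_mul_ncard_edgeSet_le {n : ℕ} (G : SimpleGraph (Fin n)) :
    2 * G.edgeSet.ncard ≤ n ^ 2 := by
  classical
  rw [two_mul_ncard_edgeSet]
  calc _ ≤ ∑ _v : Fin n, n := sum_le_sum fun v _ => by simpa using card_le_univ {w | G.Adj v w}
    _ = n ^ 2 := by simp [sq]

/-- Without boundedness the supremum in `ℕ` would be the default value `0`. -/
lemma bddAbove_rtNum_set {W : Type*} (n : ℕ) (H : SimpleGraph W) (m : ℝ) :
    BddAbove {e : ℕ | ∃ G : SimpleGraph (Fin n),
      H.Free G ∧ (G.indepNum : ℝ) < m ∧ G.edgeSet.ncard = e} := by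
  refine ⟨n ^ 2, ?_⟩
  rintro _ ⟨G, -, -, rfl⟩
  have := two_mul_ncard_edgeSet_le G
  omega

lemma ncard_edgeSet_le_rtNum {W : Type*} {n : ℕ} {H : SimpleGraph W} {m : ℝ}
    {G : SimpleGraph (Fin n)} (hG : H.Free G) (hα : (G.indepNum : ℝ) < m) :
    G.edgeSet.ncard ≤ rtNum n H m :=
  le_csSup (bddAbove_rtNum_set n H m) ⟨G, hG, hα, rfl⟩

lemma rtNum_le {W : Type*} {n : ℕ} {H : SimpleGraph W} {m B : ℝ} (hB : 0 ≤ B)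
    (h : ∀ G : SimpleGraph (Fin n), H.Free G → (G.indepNum : ℝ) < m →
      (G.edgeSet.ncard : ℝ) ≤ B) : (rtNum n H m : ℝ) ≤ B := by
  rcases Set.eq_empty_or_nonempty {e : ℕ | ∃ G : SimpleGraph (Fin n),
      H.Free G ∧ (G.indepNum : ℝ) < m ∧ G.edgeSet.ncard = e} with he | hne
  -- With no admissible graph the supremum is `0`, hence the assumption `0 ≤ B`.
  · rw [rtNum, he]; simpa using hB
  · obtain ⟨G, hG, hα, hGe⟩ := Nat.sSup_mem hne (bddAbove_rtNum_set n H m)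
    rw [rtNum, ← hGe]
    exact h G hG hα

lemma rtNum_div_sq_le_one {W : Type*} (n : ℕ) (H : SimpleGraph W) (m : ℝ) :
    (rtNum n H m : ℝ) / (n : ℝ) ^ 2 ≤ 1 := by
  refine div_le_one_of_le₀ (rtNum_le (by positivity) fun G _ _ => ?_) (by positivity)
  have := two_mul_ncard_edgeSet_le G
  exact_mod_cast (by omega : G.edgeSet.ncard ≤ n ^ 2)

lemma isBoundedUnder_le_rtNum {W : Type*} (H : SimpleGraph W) (g : ℕ → ℝ) :
    IsBoundedUnder (· ≤ ·) atTop fun n : ℕ => (rtNum n H (g n) : ℝ) / (n : ℝ) ^ 2 :=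
  isBoundedUnder_of ⟨1, fun n => rtNum_div_sq_le_one n H (g n)⟩

lemma isBoundedUnder_ge_rtNum {W : Type*} (H : SimpleGraph W) (g : ℕ → ℝ) :
    IsBoundedUnder (· ≥ ·) atTop fun n : ℕ => (rtNum n H (g n) : ℝ) / (n : ℝ) ^ 2 :=
  isBoundedUnder_of ⟨0, fun n => by positivity⟩

/-! ### The two density bounds. -/

/-- The upper bound on the Ramsey–Turán density. -/
theorem upperDensity_le {p q k : ℕ} (hp : 3 ≤ p) (hq : 2 ≤ q) (hk : k ≤ p * q - 1) {ω : ℕ → ℝ}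
    (hω : Tendsto ω atTop atTop) (hgap : RamseyGap p (fFun q ω)) {g : ℕ → ℝ}
    (hg : ∀ᶠ n in atTop, g n ≤ (invRamsey p (fFun q ω n) : ℝ)) :
    upperDensity (⊤ : SimpleGraph (Fin k)) g ≤ 1 / 2 * (1 - 1 / ((q : ℝ) - 1)) := by
  classical
  have hq1 : (1 : ℝ) ≤ (q : ℝ) - 1 := by
    have : (2 : ℝ) ≤ q := by exact_mod_cast hq
    linarith
  have hc0 : 0 ≤ 1 - 1 / ((q : ℝ) - 1) := by
    rw [sub_nonneg, div_le_one (by linarith)]; exact hq1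
  refine le_of_forall_pos_le_add fun ε hε => ?_
  refine limsup_le_of_le (isBoundedUnder_ge_rtNum _ g).isCoboundedUnder_le ?_
  filter_upwards [hg, eventually_not_cliqueFree hp hq hω hgap (ε := min ε 1) (by positivity)
    (min_le_right _ _), eventually_ge_atTop 1] with n hgn hn hn1
  have hn0 : (0 : ℝ) < n := by exact_mod_cast hn1
  rw [div_le_iff₀ (by positivity)]
  refine rtNum_le (by positivity) fun G hG hα => ?_
  have hfree : G.CliqueFree (p * q - 1) := by
    refine SimpleGraph.CliqueFree.mono hk ?_
    have := SimpleGraph.cliqueFree_iff_top_free (G := G) (β := Fin k)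
    rw [Fintype.card_fin] at this
    exact this.2 hG
  have hlt := not_le.1 fun h => hn G (by exact_mod_cast hα.trans_le hgn) h hfree
  have h2 : (2 * G.edgeSet.ncard : ℝ) = ∑ v, (#{w | G.Adj v w} : ℝ) := by
    exact_mod_cast two_mul_ncard_edgeSet G
  rw [← h2] at hlt
  have h3 : min ε 1 * (n : ℝ) ^ 2 ≤ ε * (n : ℝ) ^ 2 :=
    mul_le_mul_of_nonneg_right (min_le_left _ _) (by positivity)
  nlinarith

/-- The join of `r` copies of an extremal graph for `Q(t + 1, n / r)`, restricted to `n`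
vertices. -/
theorem le_rtNum {n r t k : ℕ} (hr : 1 ≤ r) (ht : 1 ≤ t) (hk : r * t < k) {m : ℝ}
    (hm : (invRamsey (t + 1) ((n : ℝ) / r) : ℝ) < m) :
    1 / 2 * ((1 - 1 / (r : ℝ)) * (n : ℝ) ^ 2 - n) ≤ rtNum n (⊤ : SimpleGraph (Fin k)) m := by
  classical
  have hr0 : (0 : ℝ) < r := by exact_mod_cast hr
  obtain ⟨H, hH, hHα⟩ : ∃ H : SimpleGraph (Fin ⌈(n : ℝ) / r⌉₊), H.CliqueFree (t + 1) ∧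
      H.indepNum = invRamsey (t + 1) ((n : ℝ) / r) :=
    Nat.sInf_mem (s := {a : ℕ | ∃ G : SimpleGraph (Fin ⌈(n : ℝ) / r⌉₊),
      G.CliqueFree (t + 1) ∧ G.indepNum = a}) ⟨_, ⊥, SimpleGraph.cliqueFree_bot (by omega), rfl⟩
  have hlt : ∀ v : Fin n, (v : ℕ) / r < ⌈(n : ℝ) / r⌉₊ := by
    intro v
    rw [Nat.lt_ceil]
    refine (Nat.cast_div_le).trans_lt ?_
    exact div_lt_div_of_pos_right (by exact_mod_cast v.2) hr0
  -- Vertex `v` is placed in copy `v % r` at position `v / r`; this needs no divisibility of `n` by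
  -- `r`.
  let φ : Fin n → Fin ⌈(n : ℝ) / r⌉₊ := fun v => ⟨v / r, hlt v⟩
  have hφ : ∀ v w : Fin n, (v : ℕ) % r = w % r → φ v = φ w → v = w := by
    intro v w h1 h2
    have h3 : (v : ℕ) / r = w / r := congrArg Fin.val h2
    ext
    rw [← Nat.div_add_mod (v : ℕ) r, ← Nat.div_add_mod (w : ℕ) r, h1, h3]
  obtain ⟨G, hGadj⟩ : ∃ G : SimpleGraph (Fin n), ∀ v w,
      G.Adj v w ↔ (v : ℕ) % r ≠ w % r ∨ H.Adj (φ v) (φ w) :=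
    ⟨{ Adj := fun v w => (v : ℕ) % r ≠ w % r ∨ H.Adj (φ v) (φ w)
       symm := ⟨fun v w h => h.imp Ne.symm fun h => h.symm⟩
       loopless := ⟨fun v h => h.elim (fun h => h rfl) (H.loopless.irrefl _)⟩ },
      fun _ _ => Iff.rfl⟩
  have hGfree : G.CliqueFree k := by
    intro S hS
    -- Pigeonhole: some copy would contain more than `t` vertices of the clique.
    obtain ⟨c, -, hc⟩ := exists_lt_card_fiber_of_mul_lt_card_of_maps_to
      (s := S) (t := range r) (f := fun v : Fin n => (v : ℕ) % r) (n := t)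
      (fun v _ => mem_range.2 (Nat.mod_lt _ hr)) (by rw [card_range, hS.2]; exact hk)
    set S' : Finset (Fin n) := S.filter fun v : Fin n => (v : ℕ) % r = c
    have hinj : Set.InjOn φ S' := fun v hv w hw h =>
      hφ v w ((mem_filter.1 hv).2.trans (mem_filter.1 hw).2.symm) h
    have hcl : H.IsNClique #S' (S'.image φ) := by
      refine ⟨?_, card_image_of_injOn hinj⟩
      intro a ha b hb hab
      obtain ⟨v, hv, rfl⟩ := mem_image.1 (mem_coe.1 ha)
      obtain ⟨w, hw, rfl⟩ := mem_image.1 (mem_coe.1 hb)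
      have hvw : G.Adj v w :=
        hS.1 (mem_filter.1 hv).1 (mem_filter.1 hw).1 (fun h => hab (by rw [h]))
      exact ((hGadj _ _).1 hvw).resolve_left
        (fun h => h ((mem_filter.1 hv).2.trans (mem_filter.1 hw).2.symm))
    exact hcl.not_cliqueFree (hH.mono hc)
  have hGα : G.indepNum ≤ H.indepNum := by
    obtain ⟨S, hS⟩ := G.exists_isNIndepSet_indepNum
    have hmod : ∀ v ∈ S, ∀ w ∈ S, (v : ℕ) % r = w % r := by
      intro v hv w hw
      by_contra h
      exact hS.1 hv hw (fun e => h (by rw [e])) ((hGadj _ _).2 (Or.inl h))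
    have hinj : Set.InjOn φ S := fun v hv w hw h => hφ v w (hmod v hv w hw) h
    refine le_indepNum_of_isNIndepSet (S := S.image φ)
      ⟨?_, (card_image_of_injOn hinj).trans hS.2⟩
    intro a ha b hb hab
    obtain ⟨v, hv, rfl⟩ := mem_image.1 (mem_coe.1 ha)
    obtain ⟨w, hw, rfl⟩ := mem_image.1 (mem_coe.1 hb)
    exact fun h => hS.1 hv hw (fun h => hab (by rw [h])) ((hGadj _ _).2 (Or.inr h))
  have hdeg : ∀ v : Fin n, (n : ℝ) - (n / r + 1) ≤ #{w | G.Adj v w} := by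
    intro v
    have h1 : #{w : Fin n | (w : ℕ) % r = v % r} ≤ ⌈(n : ℝ) / r⌉₊ := by
      refine (card_le_card_of_injOn φ (t := univ) (fun _ _ => mem_coe.2 (mem_univ _)) ?_).trans
        (by simp)
      intro w hw w' hw' h
      exact hφ w w' ((mem_filter.1 hw).2.trans (mem_filter.1 hw').2.symm) h
    have h2 : #{w : Fin n | (w : ℕ) % r = v % r} + #{w : Fin n | ¬ (w : ℕ) % r = v % r} = n := by
      rw [card_filter_add_card_filter_not]; simp
    have h3 : #{w : Fin n | ¬ (w : ℕ) % r = v % r} ≤ #{w | G.Adj v w} := by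
      refine card_le_card fun w hw => ?_
      rw [mem_filter] at hw ⊢
      exact ⟨mem_univ _, (hGadj _ _).2 (Or.inl (Ne.symm hw.2))⟩
    have h4 : (⌈(n : ℝ) / r⌉₊ : ℝ) ≤ n / r + 1 := (Nat.ceil_lt_add_one (by positivity)).le
    have h5 : (n : ℝ) ≤ ⌈(n : ℝ) / r⌉₊ + #{w | G.Adj v w} := by
      exact_mod_cast (by omega : n ≤ ⌈(n : ℝ) / r⌉₊ + #{w | G.Adj v w})
    linarith
  have hGtop : (⊤ : SimpleGraph (Fin k)).Free G := by
    have := SimpleGraph.cliqueFree_iff_top_free (G := G) (β := Fin k)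
    rw [Fintype.card_fin] at this
    exact this.1 hGfree
  have hle : (G.edgeSet.ncard : ℝ) ≤ rtNum n (⊤ : SimpleGraph (Fin k)) m := by
    refine Nat.cast_le.2 (ncard_edgeSet_le_rtNum hGtop (lt_of_le_of_lt ?_ hm))
    rw [← hHα]
    exact_mod_cast hGα
  have h2 : (2 * G.edgeSet.ncard : ℝ) = ∑ v, (#{w | G.Adj v w} : ℝ) := by
    exact_mod_cast two_mul_ncard_edgeSet G
  have h3 := sum_le_sum fun v (_ : v ∈ (univ : Finset (Fin n))) => hdeg v
  rw [sum_const, card_univ, Fintype.card_fin, nsmul_eq_mul, ← h2] at h3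
  have h4 : (1 - 1 / (r : ℝ)) * (n : ℝ) ^ 2 - n = n * ((n : ℝ) - (n / r + 1)) := by
    field_simp
    ring
  linarith

/-- The lower bound on the Ramsey–Turán density. -/
theorem le_lowerDensity {r t k : ℕ} (hr : 1 ≤ r) (ht : 1 ≤ t) (hk : r * t < k) {g : ℕ → ℝ}
    (hg : ∀ᶠ n : ℕ in atTop, (invRamsey (t + 1) ((n : ℝ) / r) : ℝ) < g n) :
    1 / 2 * (1 - 1 / (r : ℝ)) ≤ lowerDensity (⊤ : SimpleGraph (Fin k)) g := by
  refine le_of_forall_pos_sub_le fun ε hε => ?_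
  refine le_liminf_of_le (isBoundedUnder_le_rtNum _ g).isCoboundedUnder_ge ?_
  filter_upwards [hg, tendsto_natCast_atTop_atTop.eventually_ge_atTop (1 / ε),
    eventually_ge_atTop 1] with n hgn hn hn1
  have hn0 : (0 : ℝ) < n := by exact_mod_cast hn1
  rw [le_div_iff₀ (by positivity)]
  refine le_trans ?_ (le_rtNum hr ht hk hgn)
  rw [div_le_iff₀ hε] at hn
  nlinarith

end RamseyTuran

/-! ### Assembly of the theorem. -/

theorem mainTheorem4 (p q : ℕ) (hp : 3 ≤ p) (hq : 2 ≤ q)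
    (ω : ℕ → ℝ) (hω : Filter.Tendsto ω Filter.atTop Filter.atTop) :
    -- (a)
    (RamseyTuran.RamseyGap p (RamseyTuran.fFun q ω) →
      RamseyTuran.upperDensity (⊤ : SimpleGraph (Fin (p * q - 1)))
          (fun n => (RamseyTuran.invRamsey p (RamseyTuran.fFun q ω n) : ℝ))
        ≤ 1 / 2 * (1 - 1 / ((q : ℝ) - 1))) ∧
    -- (b)
    (∀ i t : ℕ, 1 ≤ i → i ≤ p - 1 → t = (p * q - i - 1) / (q - 1) →
      p ≤ t ∧
      ∀ g : ℕ → ℝ,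
        (∀ᶠ n : ℕ in Filter.atTop,
          (RamseyTuran.invRamsey (t + 1) ((n : ℝ) / ((q : ℝ) - 1)) : ℝ) < g n ∧
          g n ≤ (RamseyTuran.invRamsey p (RamseyTuran.fFun q ω n) : ℝ)) →
        1 / 2 * (1 - 1 / ((q : ℝ) - 1))
            ≤ RamseyTuran.lowerDensity (⊤ : SimpleGraph (Fin (p * q - i))) g ∧
        (RamseyTuran.RamseyGap p (RamseyTuran.fFun q ω) →
          RamseyTuran.HasDensity (⊤ : SimpleGraph (Fin (p * q - i))) g
            (1 / 2 * (1 - 1 / ((q : ℝ) - 1))))) := by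
  refine ⟨fun hgap => RamseyTuran.upperDensity_le hp hq le_rfl hω hgap
    (Eventually.of_forall fun _ => le_rfl), fun i t hi hip ht => ?_⟩
  obtain ⟨r, rfl⟩ : ∃ r, q = r + 1 := ⟨q - 1, by omega⟩
  have hr : 1 ≤ r := by omega
  have hqr : (((r + 1 : ℕ) : ℝ) - 1) = r := by push_cast; ring
  have hmul : p * (r + 1) = p * r + p := by ring
  rw [Nat.add_sub_cancel] at ht
  -- As `i + 1 ≤ p`, `p * r ≤ p * (r + 1) - i - 1`.
  have hpt : p ≤ t := by
    rw [ht, Nat.le_div_iff_mul_le hr]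
    omega
  refine ⟨hpt, fun g hg => ?_⟩
  have hlow : 1 / 2 * (1 - 1 / (((r + 1 : ℕ) : ℝ) - 1)) ≤
      RamseyTuran.lowerDensity (⊤ : SimpleGraph (Fin (p * (r + 1) - i))) g := by
    rw [hqr]
    refine RamseyTuran.le_lowerDensity (t := t) hr (by omega) ?_ ?_
    · have : r * t ≤ p * (r + 1) - i - 1 := by rw [ht]; exact Nat.mul_div_le _ _
      omega
    · rw [hqr] at hg
      exact hg.mono fun n h => h.1
  refine ⟨hlow, fun hgap => ?_⟩
  have hup := RamseyTuran.upperDensity_le (k := p * (r + 1) - i) hp hq (by omega) hω hgap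
    (hg.mono fun n h => h.2)
  have hle : RamseyTuran.lowerDensity (⊤ : SimpleGraph (Fin (p * (r + 1) - i))) g ≤
      RamseyTuran.upperDensity (⊤ : SimpleGraph (Fin (p * (r + 1) - i))) g :=
    liminf_le_limsup (RamseyTuran.isBoundedUnder_le_rtNum _ g)
      (RamseyTuran.isBoundedUnder_ge_rtNum _ g)
  exact ⟨le_antisymm hup (hlow.trans hle), le_antisymm (hle.trans hup) hlow⟩
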